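/- A conjunctive query (CQ) over a finite relational schema $\sigma$ (all arities positive) is a formula $q(\bar x)=\exists\bar y\bigwedge_{i=1}^m R_i(\bar x_i)$ whose free variables are exactly those in $\bar x$; it is Boolean if $\bar x$ is empty. For a database $D$ (a finite set of facts), $q(D)$ is the set of tuples $\bar a$ such that some homomorphism from the set of atoms of $q$ to $D$ maps $\bar x$ to $\bar a$. Write $q\subseteq q'$ if $q(D)\subseteq q'(D)$ for every database $D$. A tree decomposition of $q$ is a pair $(T,\chi)$ where $T$ is a finite tree and $\chi$ assigns to each node of $T$ a set of existentially quantified variables of $q$, such that for every atom $R_i(\bar x_i)$ some $\chi(t)$ contains all existentially quantified variables of $\bar x_i$, and for every existentially quantified variable $y$ the set of nodes $t$ with $y\in\chi(t)$ is connected in $T$. The width of a node $t$ is the least number of atoms of $q$ whose variables cover $\chi(t)$, the width of $(T,\chi)$ is the maximum width of its nodes, and the generalized hypertreewidth of $q$ is the minimum width of its tree decompositions. $\mathsf{GHW}(k)$ is the class of CQs of generalized hypertreewidth at most $k$. For CQs $q,q_1,q_2$ of the same arity put $q_1\sqsubseteq_q q_2$ if $q(D)\,\Delta\,q_2(D)\subseteq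 q(D)\,\Delta\,q_1(D)$ for every database $D$ (symmetric differences), and $q_1\sqsubset_q q_2$ if $q_1\sqsubseteq_q q_2$ but not $q_2\sqsubseteq_q q_1$. A CQ $q'\in\mathsf{GHW}(\ell)$ is a $\mathsf{GHW}(\ell)$-overapproximation of $q$ if $q\subseteq q'$ and there is no $q''\in\mathsf{GHW}(\ell)$ with $q\subseteq q''$ and $q'\sqsubset_q q''$. For a tournament $G$ on nodes $v_1,\dots,v_m$ with edge relation $E$, a set $B$ of nodes and a node $v\notin B$, let $\mathrm{conn}(v,B)=(e_1,\dots,e_m)$, where $e_p=\#$ if $v_p\notin B$, $e_p=1$ if $v_p\in B$ and $E(v,v_p)$, and $e_p=-1$ otherwise. Condition $(\dagger)$ says: for every $B$ with $2\le|B|\le m-2$ and every node $v\notin B$ there is a node $v'\notin B$ with $\mathrm{conn}(v,B)\ne\mathrm{conn}(v',B)$. **Theorem.** For each $k>1$ there is a tournament $G$ on $2k-1$ nodes $v_1,\dots,v_{2k-1}$ that contains the directed cycle $v_1\to v_2\to v_3\to v_1$ and satisfies $(\dagger)$, such that the Boolean CQ $q$ over a single binary relation symbol $E$ whose variables are the nodes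 of $G$ and whose atoms are the edges of $G$ belongs to $\mathsf{GHW}(k)$ and has no $\mathsf{GHW}(\ell)$-overapproximation for any $1\le\ell<k$. In particular, for each $k>1$ there is a Boolean CQ in $\mathsf{GHW}(k)$ without $\mathsf{GHW}(\ell)$-overapproximations for any $1\le\ell<k$. -/

import Mathlib

/-! # Conjunctive queries, generalized hypertreewidth and overapproximations -/

/-- A relational schema: finitely many relation symbols, each of positive arity. -/
structure Schema where
  Rel : Type
  rel_finite : Finite Rel
  arity : Rel → ℕ
  arity_pos : ∀ R, 0 < arity R

/-- An atom `R(x₁,…,xₙ)` over the schema `σ` with entries in `α`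
(variables for queries, constants for databases). -/
structure Atom (σ : Schema) (α : Type) where
  rel : σ.Rel
  args : Fin (σ.arity rel) → α

/-- The image `R(h(x₁),…,h(xₙ))` of an atom. -/
def Atom.map {σ : Schema} {α β : Type} (h : α → β) (a : Atom σ α) : Atom σ β :=
  ⟨a.rel, h ∘ a.args⟩

/-- The set of entries occurring in an atom. -/
def Atom.vars {σ : Schema} {α : Type} (a : Atom σ α) : Set α := Set.range a.args

/-- A database: a finite (possibly empty) set of facts over a nonempty ambient set `Dom` of
constants. Constants of `Dom` that occur in no fact play no role. -/
structure Database (σ : Schema) where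
  Dom : Type
  dom_nonempty : Nonempty Dom
  facts : Set (Atom σ Dom)
  facts_finite : facts.Finite

/-- A conjunctive query with `n`-ary tuple `free` of free variables (repetitions allowed), all of
which occur in some atom. All other variables are existentially quantified. For `n = 0` the query
is Boolean. -/
structure CQ (σ : Schema) (n : ℕ) where
  V : Type
  atoms : Set (Atom σ V)
  atoms_finite : atoms.Finite
  free : Fin n → V
  free_mem : ∀ i, ∃ a ∈ atoms, free i ∈ a.vars

namespace CQ

variable {σ : Schema} {n : ℕ}

/-- The result `q(D)`: all tuples `ā` such that some homomorphism from the canonical database of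
`q` (whose facts are the atoms of `q`) to `D` maps the free variables to `ā`. -/
def eval (q : CQ σ n) (D : Database σ) : Set (Fin n → D.Dom) :=
  {t | ∃ h : q.V → D.Dom, (∀ a ∈ q.atoms, a.map h ∈ D.facts) ∧ h ∘ q.free = t}

/-- Containment of queries: `q(D) ⊆ q'(D)` over every database `D`. -/
def Contained (q q' : CQ σ n) : Prop := ∀ D : Database σ, q.eval D ⊆ q'.eval D

/-- The existentially quantified variables. -/
def exVars (q : CQ σ n) : Set q.V := {y | y ∉ Set.range q.free}

/-- Tree decompositions `(T, χ)` of a conjunctive query: the bags consist of existentially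
quantified variables. -/
structure TreeDecomposition (q : CQ σ n) where
  Node : Type
  node_finite : Finite Node
  tree : SimpleGraph Node
  isTree : tree.IsTree
  bag : Node → Set q.V
  bag_subset : ∀ t, bag t ⊆ q.exVars
  atom_subset : ∀ a ∈ q.atoms, ∃ t, a.vars ∩ q.exVars ⊆ bag t
  preconnected : ∀ y ∈ q.exVars, (tree.induce {t | y ∈ bag t}).Preconnected

/-- The width of a node: the least number of atoms of `q` whose variables cover the bag. -/
noncomputable def TreeDecomposition.nodeWidth {q : CQ σ n} (T : q.TreeDecomposition)
    (t : T.Node) : ℕ∞ :=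
  ⨅ (I : Finset (Atom σ q.V)) (_ : (I : Set (Atom σ q.V)) ⊆ q.atoms)
    (_ : T.bag t ⊆ ⋃ a ∈ I, a.vars), (I.card : ℕ∞)

/-- The width of a tree decomposition: the maximum width of its nodes. -/
noncomputable def TreeDecomposition.width {q : CQ σ n} (T : q.TreeDecomposition) : ℕ∞ :=
  ⨆ t, T.nodeWidth t

/-- The generalized hypertreewidth: the minimum width of a tree decomposition. -/
noncomputable def ghw (q : CQ σ n) : ℕ∞ := ⨅ T : q.TreeDecomposition, T.width

/-- The class `GHW(k)` of queries of generalized hypertreewidth at most `k`. -/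
def GHW (k : ℕ) : Set (CQ σ n) := {q | q.ghw ≤ k}

/-- The order `q₁ ⊑_q q₂`: over every database, the symmetric difference of `q₂` and `q` is
contained in the symmetric difference of `q₁` and `q`. -/
def ApproxLE (q q₁ q₂ : CQ σ n) : Prop :=
  ∀ D : Database σ, symmDiff (q.eval D) (q₂.eval D) ⊆ symmDiff (q.eval D) (q₁.eval D)

/-- The strict part `q₁ ⊏_q q₂` of `⊑_q`. -/
def ApproxLT (q q₁ q₂ : CQ σ n) : Prop := ApproxLE q q₁ q₂ ∧ ¬ ApproxLE q q₂ q₁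

/-- `q'` is a `GHW(k)`-overapproximation of `q`: it is `⊑_q`-maximal among the queries in
`GHW(k)` that contain `q`. -/
def IsOverapproximation (k : ℕ) (q q' : CQ σ n) : Prop :=
  q' ∈ GHW k ∧ q.Contained q' ∧
    ¬ ∃ q'' : CQ σ n, q'' ∈ GHW k ∧ q.Contained q'' ∧ ApproxLT q q' q''

end CQ

/-- The schema of directed graphs: a single binary relation symbol `E`. -/
def graphSchema : Schema where
  Rel := Unit
  rel_finite := inferInstance
  arity := fun _ => 2
  arity_pos := fun _ => Nat.succ_pos 1

/-- The atom `E(u, v)`. -/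
def edgeAtom {V : Type} (u v : V) : Atom graphSchema V := ⟨(), ![u, v]⟩

/-- The Boolean query whose variables are the nodes of `G` and whose atoms are `E(u, v)` for the
edges `(u, v)` of `G`, that is, the Boolean query whose canonical database is `G`. -/
def digraphCQ {V : Type} [Finite V] (G : Digraph V) : CQ graphSchema 0 where
  V := V
  atoms := {a | ∃ u v, G.Adj u v ∧ a = edgeAtom u v}
  atoms_finite := (Set.finite_range fun p : V × V => edgeAtom p.1 p.2).subset (by
    rintro _ ⟨u, v, -, rfl⟩
    exact ⟨(u, v), rfl⟩)
  free := Fin.elim0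
  free_mem := fun i => i.elim0

/-- Tournaments: no loops, and exactly one of the two edges between any two distinct nodes. -/
def IsTournament {V : Type} (G : Digraph V) : Prop :=
  (∀ u, ¬ G.Adj u u) ∧ ∀ u v, u ≠ v → Xor (G.Adj u v) (G.Adj v u)

/-- The first three nodes `v₁, v₂, v₃` form a directed cycle `v₁ → v₂ → v₃ → v₁`
(the node `v_{i+1}` is the element `i` of `Fin m`). -/
def FirstThreeCycle {m : ℕ} (G : Digraph (Fin m)) : Prop :=
  ∃ h : 3 ≤ m, G.Adj ⟨0, by omega⟩ ⟨1, by omega⟩ ∧ G.Adj ⟨1, by omega⟩ ⟨2, by omega⟩ ∧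
    G.Adj ⟨2, by omega⟩ ⟨0, by omega⟩

open Classical in
/-- The tuple `conn(v, B)`, which records how `v` is connected with the nodes in `B`. The symbol
`#` is `none`. -/
noncomputable def conn {m : ℕ} (G : Digraph (Fin m)) (v : Fin m) (B : Finset (Fin m)) :
    Fin m → Option ℤ :=
  fun p => if p ∉ B then none else if G.Adj v p then some 1 else some (-1)

/-- Condition (†) for a graph on `m` nodes: for each set `B` of nodes with `2 ≤ |B| ≤ m - 2` and
each node `v` outside `B` there is a node `v'` outside `B` with `conn(v, B) ≠ conn(v', B)`. -/
def Dagger {m : ℕ} (G : Digraph (Fin m)) : Prop :=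
  ∀ B : Finset (Fin m), 2 ≤ B.card → B.card + 2 ≤ m →
    ∀ v ∉ B, ∃ v' ∉ B, conn G v B ≠ conn G v' B

/-!
An overapproximation `q'` of a Boolean query `q` is contained in every query `p` of `GHW ℓ` that
contains `q`, since otherwise the conjunction of `q'` and `p` would be strictly better.

In the tournament on the residues modulo `m = 2 * k - 1` with an edge from `i` to `j` whenever the
residue of `j - i` is odd, unroll the cycle: the band query of width `2 * ℓ < m` has variables
`0, 1, …, N - 1`, of which those at distance less than `2 * ℓ` are joined as their residues are.
It is in `GHW ℓ`, the bags being the intervals of length `2 * ℓ`, and reduction modulo `m` maps it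
to the tournament. So if `q'` is an overapproximation of the tournament, every band query has a
homomorphism `y` to `q'`.

Since `q'` maps to a tournament, it has no loops and no edges in both directions, hence
`y a ≠ y b` for `a < b ≤ a + 2 * ℓ`. If `y a = y b` is a first repetition, then `y a`, …,
`y (a + 2 * ℓ - 1)` and the remaining path from `y (a + 2 * ℓ)` to `y (b - 1)` are `2 * ℓ + 1`
disjoint connected sets of variables, any two of them joined by an atom. By the Helly property of
subtrees some bag of a tree decomposition of `q'` meets all of them, so it is not covered by `ℓ`
binary atoms, although `q'` is in `GHW ℓ`. Hence `y` is injective for every `N`, which is impossible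
as `q'` is finite.
-/

section Trees

open SimpleGraph

variable {V W : Type*} {G : SimpleGraph V} {H : SimpleGraph W}

theorem isTree_sum_sup_edge [Finite V] [Finite W] (hG : G.IsTree) (hH : H.IsTree) (v : V)
    (w : W) : (G.sum H ⊔ edge (.inl v) (.inr w)).IsTree := by
  have hsum : Nat.card (G.sum H).edgeSet = Nat.card G.edgeSet + Nat.card H.edgeSet := by
    rw [Nat.card_congr edgeSetSumEquiv, Nat.card_sum]
  have hnew : s(.inl v, .inr w) ∉ (G.sum H).edgeSet := by
    rw [mem_edgeSet]
    exact not_adj_sum_inl_inr v w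
  have hedges : (G.sum H ⊔ edge (.inl v) (.inr w)).edgeSet =
      insert s(.inl v, .inr w) (G.sum H).edgeSet := by
    rw [edgeSet_sup, edgeSet_edge_of_ne Sum.inl_ne_inr, Set.union_singleton]
  have hGcard := (isTree_iff_connected_and_card.1 hG).2
  have hHcard := (isTree_iff_connected_and_card.1 hH).2
  refine isTree_iff_connected_and_card.2 ⟨hG.connected.sum_sup_edge hH.connected, ?_⟩
  rw [hedges, Nat.card_coe_set_eq, Set.ncard_insert_of_notMem hnew, ← Nat.card_coe_set_eq,
    Nat.card_sum]
  omega

theorem isTree_pathGraph_succ (n : ℕ) : (pathGraph (n + 1)).IsTree := by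
  have hconn := pathGraph_connected n
  have hsub : (pathGraph (n + 1)).edgeSet ⊆ Set.range fun i : Fin n => s(i.castSucc, i.succ) := by
    intro e
    induction e using Sym2.ind with | _ u v =>
    rw [mem_edgeSet, pathGraph_adj]
    rintro (h | h)
    · exact ⟨⟨u, by omega⟩, Sym2.eq_iff.2 (.inl ⟨rfl, Fin.ext h⟩)⟩
    · exact ⟨⟨v, by omega⟩, Sym2.eq_iff.2 (.inr ⟨rfl, Fin.ext h⟩)⟩
  have hle : Nat.card (pathGraph (n + 1)).edgeSet ≤ n := by
    calc Nat.card (pathGraph (n + 1)).edgeSet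
      _ ≤ _ := Nat.card_mono (Set.finite_range _) hsub
      _ ≤ Nat.card (Fin n) := Finite.card_range_le _
      _ = n := Nat.card_fin n
  have hge := hconn.card_vert_le_card_edgeSet_add_one
  refine isTree_iff_connected_and_card.2 ⟨hconn, ?_⟩
  rw [Nat.card_fin] at hge ⊢
  omega

theorem preconnected_induce_image {α : Type*} [LinearOrder α] [SuccOrder α] [IsSuccArchimedean α]
    {s : Set α} (hs : s.OrdConnected) {f : α → V}
    (hf : ∀ i ∈ s, ∀ j ∈ s, i ⋖ j → G.Adj (f i) (f j)) :
    (G.induce (f '' s)).Preconnected := by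
  let φ : hasse s →g G.induce (f '' s) :=
    { toFun := fun i => ⟨f i, i, i.2, rfl⟩
      map_rel' := fun {i j} h => by
        have hcov : ∀ {i j : s}, i ⋖ j → (i : α) ⋖ j := fun h =>
          h.image (OrderEmbedding.subtype _) (by simpa using hs)
        rcases h with h | h
        · exact hf i i.2 j j.2 (hcov h)
        · exact (hf j j.2 i i.2 (hcov h)).symm }
  refine (hasse_preconnected_of_succ s).map φ ?_
  rintro ⟨_, i, hi, rfl⟩
  exact ⟨⟨i, hi⟩, rfl⟩

theorem preconnected_induce_image_hom (f : G →g H) {s : Set V}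
    (hs : (G.induce s).Preconnected) : (H.induce (f '' s)).Preconnected := by
  let φ : G.induce s →g H.induce (f '' s) := ⟨fun x => ⟨f x, x, x.2, rfl⟩, fun h => f.map_rel h⟩
  refine hs.map φ ?_
  rintro ⟨_, x, hx, rfl⟩
  exact ⟨⟨x, hx⟩, rfl⟩

theorem support_subset_of_preconnected_induce (hG : G.IsAcyclic) {s : Set V}
    (hs : (G.induce s).Preconnected) {u v : V} (hu : u ∈ s) (hv : v ∈ s) {p : G.Walk u v}
    (hp : p.IsPath) : ∀ x ∈ p.support, x ∈ s := by
  obtain ⟨r, hr⟩ := (hs ⟨u, hu⟩ ⟨v, hv⟩).exists_isPath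
  let r' : G.Walk u v := r.map (Embedding.induce s).toHom
  have hr' : r'.IsPath := hr.map Subtype.val_injective
  have hrs : ∀ x ∈ r'.support, x ∈ s := by
    intro x hx
    obtain ⟨y, -, rfl⟩ := List.mem_map.1 (Walk.support_map _ r ▸ hx)
    exact y.2
  have := hG.subsingleton_path u v
  have hpr : p = r' := congrArg Subtype.val (Subsingleton.elim (⟨p, hp⟩ : G.Path u v) ⟨r', hr'⟩)
  exact hpr ▸ hrs

/-- The node of `s` closest to `t` is the gate through which every path from `t` enters `s`. -/
theorem exists_mem_forall_isPath_mem_support (hG : G.IsTree) {s : Set V} (hne : s.Nonempty)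
    (hs : (G.induce s).Preconnected) (t : V) :
    ∃ w ∈ s, ∀ z ∈ s, ∀ p : G.Walk t z, p.IsPath → w ∈ p.support := by
  classical
  obtain ⟨w, hw, hmin⟩ : ∃ w ∈ s, ∀ x ∈ s, G.dist t w ≤ G.dist t x :=
    ⟨_, Function.argminOn_mem _ s hne, fun x hx => Function.argminOn_le _ s hx⟩
  refine ⟨w, hw, fun z hz p hp => ?_⟩
  obtain ⟨q, hq, hqw⟩ := (hG.connected t w).exists_path_of_dist
  obtain ⟨r, hr⟩ := (hG.connected w z).exists_isPath
  have hqs : ∀ x ∈ q.support, x ∈ s → x = w := by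
    intro x hx hxs
    by_contra hne
    have hlt := q.length_takeUntil_lt_length hx hne
    have hle := (hmin x hxs).trans (dist_le (q.takeUntil x hx))
    omega
  have hqr : (q.append r).IsPath := by
    have hwr : w ∉ r.support.tail := by
      have := hr.support_nodup
      rw [← r.cons_tail_support] at this
      exact (List.nodup_cons.1 this).1
    rw [Walk.isPath_def, Walk.support_append, List.nodup_append']
    refine ⟨hq.support_nodup, hr.support_nodup.tail, fun x hxq hxr => ?_⟩
    have hxs := support_subset_of_preconnected_induce hG.isAcyclic hs hw hz hr x
      (List.mem_of_mem_tail hxr)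
    exact hwr (hqs x hxq hxs ▸ hxr)
  rw [(hG.existsUnique_path t z).unique hp hqr]
  exact (Walk.mem_support_append_iff _ _).2 (.inl q.end_mem_support)

/-- The Helly property of subtrees. -/
theorem exists_mem_forall_of_pairwise_inter (hG : G.IsTree) {ι : Type*} [Finite ι]
    {S : ι → Set V} (hS : ∀ i, (G.induce (S i)).Preconnected)
    (hinter : ∀ i j, (S i ∩ S j).Nonempty) : ∃ t, ∀ i, t ∈ S i := by
  classical
  have := Fintype.ofFinite ι
  suffices h : ∀ F : Finset ι, ∃ t, ∀ i ∈ F, t ∈ S i by simpa using h Finset.univ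
  intro F
  induction F using Finset.induction_on with
  | empty => simpa using hG.connected.nonempty
  | insert a F _ ih =>
    obtain ⟨t, ht⟩ := ih
    obtain ⟨w, hwa, hw⟩ := exists_mem_forall_isPath_mem_support hG
      ((hinter a a).mono Set.inter_subset_left) (hS a) t
    refine ⟨w, Finset.forall_mem_insert _ _ _ |>.2 ⟨hwa, fun j hj => ?_⟩⟩
    obtain ⟨z, hzj, hza⟩ := hinter j a
    obtain ⟨p, hp⟩ := (hG.connected t z).exists_isPath
    exact support_subset_of_preconnected_induce hG.isAcyclic (hS j) (ht j hj) hzj hp w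
      (hw z hza p hp)

end Trees

theorem Atom.vars_map {σ : Schema} {α β : Type} (f : α → β) (a : Atom σ α) :
    (a.map f).vars = f '' a.vars :=
  Set.range_comp f a.args

namespace CQ

variable {σ : Schema} {n k : ℕ} {p q : CQ σ n}

/-- Homomorphisms from `p` to `q`: maps of variables that preserve atoms and the free tuple. -/
def IsHom (p q : CQ σ n) (f : p.V → q.V) : Prop :=
  (∀ a ∈ p.atoms, a.map f ∈ q.atoms) ∧ f ∘ p.free = q.free

theorem IsHom.contained {f : p.V → q.V} (hf : IsHom p q f) : q.Contained p := by
  rintro D _ ⟨h, hh, rfl⟩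
  exact ⟨h ∘ f, fun a ha => hh _ (hf.1 a ha), by rw [Function.comp_assoc, hf.2]⟩

/-- The canonical database of a query: its facts are the atoms. -/
def canonicalDatabase (q : CQ σ n) [h : Nonempty q.V] : Database σ where
  Dom := q.V
  dom_nonempty := h
  facts := q.atoms
  facts_finite := q.atoms_finite

theorem Contained.exists_isHom [Nonempty q.V] (h : q.Contained p) : ∃ f, IsHom p q f :=
  h q.canonicalDatabase ⟨id, fun _ ha => ha, rfl⟩

theorem Contained.atoms_nonempty (h : q.Contained p) (hp : p.atoms.Nonempty) :
    q.atoms.Nonempty := by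
  by_contra hq
  let D : Database σ := ⟨Unit, ⟨()⟩, ∅, Set.finite_empty⟩
  have hqD : (fun _ => ()) ∈ q.eval D :=
    ⟨fun _ => (), fun a ha => absurd ⟨a, ha⟩ hq, rfl⟩
  obtain ⟨g, hg, -⟩ := h D hqD
  obtain ⟨a, ha⟩ := hp
  exact hg a ha

theorem nonempty_of_atoms_nonempty (h : q.atoms.Nonempty) : Nonempty q.V := by
  obtain ⟨a, -⟩ := h
  exact ⟨a.args ⟨0, σ.arity_pos a.rel⟩⟩

/-- The variables in `s` are covered by at most `k` atoms of `q`. -/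
def CoveredBy (q : CQ σ n) (k : ℕ) (s : Set q.V) : Prop :=
  ∃ I : Finset (Atom σ q.V), ↑I ⊆ q.atoms ∧ s ⊆ ⋃ a ∈ I, a.vars ∧ I.card ≤ k

theorem CoveredBy.mono {s t : Set q.V} (h : q.CoveredBy k t) (hst : s ⊆ t) : q.CoveredBy k s := by
  obtain ⟨I, hI, ht, hk⟩ := h
  exact ⟨I, hI, hst.trans ht, hk⟩

theorem CoveredBy.image {f : p.V → q.V} (hf : IsHom p q f) {s : Set p.V}
    (h : p.CoveredBy k s) : q.CoveredBy k (f '' s) := by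
  classical
  obtain ⟨I, hI, hs, hk⟩ := h
  refine ⟨I.image (Atom.map f), ?_, ?_, Finset.card_image_le.trans hk⟩
  · rw [Finset.coe_image, Set.image_subset_iff]
    exact fun a ha => hf.1 a (hI ha)
  · simp only [Finset.set_biUnion_finset_image, Atom.vars_map, ← Set.image_iUnion₂]
    exact Set.image_mono hs

theorem CoveredBy.ncard_le {r : ℕ} (hr : ∀ R, σ.arity R ≤ r) {s : Set q.V}
    (h : q.CoveredBy k s) : s.ncard ≤ k * r := by
  obtain ⟨I, -, hs, hk⟩ := h
  have hvars : ∀ a ∈ I, a.vars.ncard ≤ r := fun a _ => by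
    have := Finite.card_range_le a.args
    rw [Nat.card_fin, Nat.card_coe_set_eq] at this
    exact this.trans (hr a.rel)
  calc s.ncard
    _ ≤ (⋃ a ∈ I, a.vars).ncard :=
      Set.ncard_le_ncard hs (I.finite_toSet.biUnion fun a _ => Set.finite_range a.args)
    _ ≤ ∑ a ∈ I, a.vars.ncard := Finset.set_ncard_biUnion_le I _
    _ ≤ I.card * r := Finset.sum_le_card_nsmul I _ r hvars
    _ ≤ k * r := Nat.mul_le_mul_right r hk

theorem TreeDecomposition.nodeWidth_le_iff (T : q.TreeDecomposition) (t : T.Node) :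
    T.nodeWidth t ≤ k ↔ q.CoveredBy k (T.bag t) := by
  simp only [← ENat.lt_natCast_add_one_iff, nodeWidth, iInf_lt_iff, exists_prop, CoveredBy]
  norm_cast
  simp only [Nat.lt_succ_iff]

theorem mem_GHW_iff : q ∈ GHW k ↔ ∃ T : q.TreeDecomposition, ∀ t, q.CoveredBy k (T.bag t) := by
  simp only [← TreeDecomposition.nodeWidth_le_iff, ← iSup_le_iff]
  change q.ghw ≤ k ↔ _
  simp only [← ENat.lt_natCast_add_one_iff, ghw, iInf_lt_iff, TreeDecomposition.width]

theorem mem_GHW_of_coveredBy_exVars (h : q.CoveredBy k q.exVars) : q ∈ GHW k := by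
  refine mem_GHW_iff.2 ⟨?_, fun _ => ?_⟩
  · exact
    { Node := Unit
      node_finite := inferInstance
      tree := ⊥
      isTree := .of_subsingleton
      bag := fun _ => q.exVars
      bag_subset := fun _ => subset_rfl
      atom_subset := fun _ _ => ⟨(), Set.inter_subset_right⟩
      preconnected := fun _ _ => .of_subsingleton }
  · exact h

/-! ### Conjunctions and overapproximations of Boolean queries -/

section Boolean

variable {p q q' : CQ σ 0}

@[simp]
theorem mem_exVars (y : q.V) : y ∈ q.exVars :=
  fun ⟨i, _⟩ => i.elim0

theorem isHom_iff {f : p.V → q.V} : IsHom p q f ↔ ∀ a ∈ p.atoms, a.map f ∈ q.atoms :=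
  and_iff_left (Subsingleton.elim _ _)

theorem mem_eval {D : Database σ} {t : Fin 0 → D.Dom} :
    t ∈ q.eval D ↔ ∃ h : q.V → D.Dom, ∀ a ∈ q.atoms, a.map h ∈ D.facts :=
  exists_congr fun _ => and_iff_left (Subsingleton.elim _ _)

/-- The conjunction of two Boolean queries, over disjoint sets of variables. -/
def conj (p q : CQ σ 0) : CQ σ 0 where
  V := p.V ⊕ q.V
  atoms := Atom.map Sum.inl '' p.atoms ∪ Atom.map Sum.inr '' q.atoms
  atoms_finite := (p.atoms_finite.image _).union (q.atoms_finite.image _)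
  free := Fin.elim0
  free_mem := fun i => i.elim0

theorem isHom_inl_conj (p q : CQ σ 0) : IsHom p (p.conj q) Sum.inl :=
  isHom_iff.2 fun a ha => .inl ⟨a, ha, rfl⟩

theorem isHom_inr_conj (p q : CQ σ 0) : IsHom q (p.conj q) Sum.inr :=
  isHom_iff.2 fun a ha => .inr ⟨a, ha, rfl⟩

theorem eval_conj (p q : CQ σ 0) (D : Database σ) :
    (p.conj q).eval D = p.eval D ∩ q.eval D := by
  refine (Set.subset_inter ((isHom_inl_conj p q).contained D)
    ((isHom_inr_conj p q).contained D)).antisymm fun t ht => ?_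
  obtain ⟨f, hf⟩ := mem_eval.1 ht.1
  obtain ⟨g, hg⟩ := mem_eval.1 ht.2
  refine mem_eval.2 ⟨Sum.elim f g, ?_⟩
  rintro _ (⟨a, ha, rfl⟩ | ⟨a, ha, rfl⟩)
  · exact hf a ha
  · exact hg a ha

/-- Tree decompositions of `p` and `q`, joined by an edge between `s` and `t`, form a tree
decomposition of the conjunction of `p` and `q`. -/
def TreeDecomposition.conj (S : p.TreeDecomposition) (T : q.TreeDecomposition) (s : S.Node)
    (t : T.Node) : (p.conj q).TreeDecomposition where
  Node := S.Node ⊕ T.Node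
  node_finite := have := S.node_finite; have := T.node_finite; inferInstance
  tree := S.tree.sum T.tree ⊔ SimpleGraph.edge (.inl s) (.inr t)
  isTree :=
    have := S.node_finite
    have := T.node_finite
    isTree_sum_sup_edge S.isTree T.isTree s t
  bag := Sum.elim (fun u => Sum.inl '' S.bag u) fun u => Sum.inr '' T.bag u
  bag_subset := fun _ _ _ => mem_exVars (q := p.conj q) _
  atom_subset := by
    rintro _ (⟨a, ha, rfl⟩ | ⟨a, ha, rfl⟩)
    · obtain ⟨u, hu⟩ := S.atom_subset a ha
      exact ⟨.inl u, Set.inter_subset_left.trans <| (Atom.vars_map Sum.inl a).trans_subset <|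
        Set.image_mono fun x hx => hu ⟨hx, mem_exVars x⟩⟩
    · obtain ⟨u, hu⟩ := T.atom_subset a ha
      exact ⟨.inr u, Set.inter_subset_left.trans <| (Atom.vars_map Sum.inr a).trans_subset <|
        Set.image_mono fun x hx => hu ⟨hx, mem_exVars x⟩⟩
  preconnected := by
    rintro (y | y) -
    · have hnodes : Sum.inl '' {u | y ∈ S.bag u} = {u | (Sum.inl y : p.V ⊕ q.V) ∈
          Sum.elim (fun u => Sum.inl '' S.bag u) (fun u => Sum.inr '' T.bag u) u} := by
        ext (u | u) <;> simp
      exact hnodes ▸ preconnected_induce_image_hom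
        ((SimpleGraph.Hom.ofLE le_sup_left).comp SimpleGraph.Embedding.sumInl.toHom)
        (S.preconnected y (mem_exVars y))
    · have hnodes : Sum.inr '' {u | y ∈ T.bag u} = {u | (Sum.inr y : p.V ⊕ q.V) ∈
          Sum.elim (fun u => Sum.inl '' S.bag u) (fun u => Sum.inr '' T.bag u) u} := by
        ext (u | u) <;> simp
      exact hnodes ▸ preconnected_induce_image_hom
        ((SimpleGraph.Hom.ofLE le_sup_left).comp SimpleGraph.Embedding.sumInr.toHom)
        (T.preconnected y (mem_exVars y))

theorem conj_mem_GHW (hp : p ∈ GHW k) (hq : q ∈ GHW k) : p.conj q ∈ GHW k := by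
  rw [mem_GHW_iff] at *
  obtain ⟨S, hS⟩ := hp
  obtain ⟨T, hT⟩ := hq
  obtain ⟨s⟩ := S.isTree.connected.nonempty
  obtain ⟨t⟩ := T.isTree.connected.nonempty
  refine ⟨S.conj T s t, ?_⟩
  rintro (u | u)
  · exact (hS u).image (isHom_inl_conj p q)
  · exact (hT u).image (isHom_inr_conj p q)

theorem IsOverapproximation.contained (h : IsOverapproximation k q q') (hp : p ∈ GHW k)
    (hqp : q.Contained p) : q'.Contained p := by
  obtain ⟨hq', hqq', hmax⟩ := h
  have hqc : q.Contained (q'.conj p) := fun D => by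
    rw [eval_conj]
    exact Set.subset_inter (hqq' D) (hqp D)
  have hle : ApproxLE q q' (q'.conj p) := by
    rintro D x (⟨hx, hxc⟩ | ⟨hxc, hx⟩)
    · exact absurd (hqc D hx) hxc
    · rw [eval_conj] at hxc
      exact .inr ⟨hxc.1, hx⟩
  have hge : ApproxLE q (q'.conj p) q' := by
    by_contra hn
    exact hmax ⟨_, conj_mem_GHW hq' hp, hqc, hle, hn⟩
  intro D x hx
  by_cases hxq : x ∈ q.eval D
  · exact hqp D hxq
  · have hxc := (hge D (.inr ⟨hx, hxq⟩)).resolve_left fun h => hxq h.1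
    rw [eval_conj] at hxc
    exact hxc.1.2

end Boolean

/-! ### Brambles -/

/-- The Gaifman graph of a query: two variables are adjacent if they occur in a common atom. -/
def gaifman (q : CQ σ n) : SimpleGraph q.V where
  Adj x y := x ≠ y ∧ ∃ a ∈ q.atoms, x ∈ a.vars ∧ y ∈ a.vars
  symm := ⟨fun _ _ ⟨hne, a, ha, hx, hy⟩ => ⟨hne.symm, a, ha, hy, hx⟩⟩
  loopless := ⟨fun _ h => h.1 rfl⟩

/-- Two sets of variables touch if some atom has a variable in each of them. -/
def Touches (q : CQ σ n) (s t : Set q.V) : Prop :=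
  ∃ a ∈ q.atoms, (a.vars ∩ s).Nonempty ∧ (a.vars ∩ t).Nonempty

theorem Touches.symm {s t : Set q.V} (h : q.Touches s t) : q.Touches t s := by
  obtain ⟨a, ha, hs, ht⟩ := h
  exact ⟨a, ha, ht, hs⟩

namespace TreeDecomposition

variable (T : q.TreeDecomposition)

theorem preconnected_induce_bag_inter_nonempty {s : Set q.V} (hs : s ⊆ q.exVars)
    (hconn : (q.gaifman.induce s).Preconnected) :
    (T.tree.induce {t | (T.bag t ∩ s).Nonempty}).Preconnected := by
  set U : Set T.Node := {t | (T.bag t ∩ s).Nonempty}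
  have hsub : ∀ x ∈ s, {t | x ∈ T.bag t} ⊆ U := fun x hx t ht => ⟨x, ht, hx⟩
  have hsame : ∀ x (hx : x ∈ s) t (ht : x ∈ T.bag t) u (hu : x ∈ T.bag u),
      (T.tree.induce U).Reachable ⟨t, x, ht, hx⟩ ⟨u, x, hu, hx⟩ := fun x hx t ht u hu =>
    (T.preconnected x (hs hx) ⟨t, ht⟩ ⟨u, hu⟩).map
      (SimpleGraph.induceHomOfLE _ (hsub x hx)).toHom
  rintro ⟨t, x, htx, hx⟩ ⟨u, y, huy, hy⟩
  have hxy := (SimpleGraph.reachable_iff_reflTransGen _ _).1 (hconn ⟨x, hx⟩ ⟨y, hy⟩)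
  generalize hy' : (⟨y, hy⟩ : s) = y' at hxy
  induction hxy generalizing u y with
  | refl =>
    cases hy'
    exact hsame x hx t htx u huy
  | @tail z _ _ hzy ih =>
    subst hy'
    obtain ⟨-, a, ha, hza, hya⟩ := hzy
    obtain ⟨v, hv⟩ := T.atom_subset a ha
    exact (ih v z (hv ⟨hza, hs z.2⟩) z.2 rfl).trans
      (hsame y hy v (hv ⟨hya, hs hy⟩) u huy)

/-- The easy direction of the duality between brambles and tree decompositions. -/
theorem exists_forall_bag_inter_nonempty {ι : Type*} [Finite ι] [Nontrivial ι]
    {X : ι → Set q.V} (hX : ∀ i, X i ⊆ q.exVars)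
    (hconn : ∀ i, (q.gaifman.induce (X i)).Preconnected)
    (htouch : Pairwise fun i j => q.Touches (X i) (X j)) :
    ∃ t, ∀ i, (T.bag t ∩ X i).Nonempty := by
  have hinter : ∀ i j, i ≠ j → ∃ t, (T.bag t ∩ X i).Nonempty ∧ (T.bag t ∩ X j).Nonempty := by
    intro i j hij
    obtain ⟨a, ha, ⟨x, hxa, hx⟩, ⟨y, hya, hy⟩⟩ := htouch hij
    obtain ⟨t, ht⟩ := T.atom_subset a ha
    exact ⟨t, ⟨x, ht ⟨hxa, hX i hx⟩, hx⟩, ⟨y, ht ⟨hya, hX j hy⟩, hy⟩⟩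
  refine exists_mem_forall_of_pairwise_inter T.isTree
    (fun i => T.preconnected_induce_bag_inter_nonempty (hX i) (hconn i)) fun i j => ?_
  rcases eq_or_ne i j with rfl | hij
  · obtain ⟨j, hij⟩ := exists_ne i
    obtain ⟨t, ht, -⟩ := hinter i j hij.symm
    exact ⟨t, ht, ht⟩
  · exact hinter i j hij

end TreeDecomposition

theorem card_le_of_touches (hq : q ∈ GHW k) {r : ℕ} (hr : ∀ R, σ.arity R ≤ r) {ι : Type*}
    [Finite ι] [Nontrivial ι] {X : ι → Set q.V} (hX : ∀ i, X i ⊆ q.exVars)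
    (hconn : ∀ i, (q.gaifman.induce (X i)).Preconnected)
    (htouch : Pairwise fun i j => q.Touches (X i) (X j))
    (hdisj : Pairwise fun i j => Disjoint (X i) (X j)) : Nat.card ι ≤ k * r := by
  obtain ⟨T, hT⟩ := mem_GHW_iff.1 hq
  obtain ⟨t, ht⟩ := T.exists_forall_bag_inter_nonempty hX hconn htouch
  choose x hxt hxX using ht
  have hinj : Function.Injective x := fun i j hij => by
    by_contra hne
    exact Set.disjoint_left.1 (hdisj hne) (hxX i) (hij ▸ hxX j)
  rw [← Set.ncard_range_of_injective hinj]
  exact ((hT t).mono (Set.range_subset_iff.2 hxt)).ncard_le hr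

end CQ

theorem edgeAtom_inj {V : Type} {u v u' v' : V} :
    edgeAtom u v = edgeAtom u' v' ↔ u = u' ∧ v = v' := by
  refine ⟨fun h => ?_, fun h => by rw [h.1, h.2]⟩
  have hargs : (![u, v] : Fin 2 → V) = ![u', v'] := eq_of_heq (Atom.mk.inj h).2
  exact ⟨congrFun hargs 0, congrFun hargs 1⟩

theorem eq_edgeAtom {V : Type} (a : Atom graphSchema V) : ∃ u v, a = edgeAtom u v := by
  obtain ⟨⟨⟩, args⟩ := a
  refine ⟨args (0 : Fin 2), args (1 : Fin 2), congrArg (Atom.mk (σ := graphSchema) ()) ?_⟩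
  exact List.ofFn_injective rfl

theorem edgeAtom_map {V W : Type} (f : V → W) (u v : V) :
    (edgeAtom u v).map f = edgeAtom (f u) (f v) :=
  congrArg (Atom.mk (σ := graphSchema) ()) (List.ofFn_injective rfl)

theorem vars_edgeAtom {V : Type} (u v : V) : (edgeAtom u v).vars = {u, v} :=
  Matrix.range_cons_cons_empty u v ![]

namespace CQ

variable {n k : ℕ}

/-- The edge relation of the canonical database of a query over the schema of directed graphs. -/
def HasEdge (q : CQ graphSchema n) (u v : q.V) : Prop := edgeAtom u v ∈ q.atoms

theorem exists_atom_of_hasEdge_or_hasEdge {q : CQ graphSchema n} {u v : q.V}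
    (h : q.HasEdge u v ∨ q.HasEdge v u) : ∃ a ∈ q.atoms, u ∈ a.vars ∧ v ∈ a.vars := by
  rcases h with h | h
  · exact ⟨_, h, by simp [vars_edgeAtom]⟩
  · exact ⟨_, h, by simp [vars_edgeAtom]⟩

theorem IsHom.hasEdge {p q : CQ graphSchema n} {f : p.V → q.V} (hf : IsHom p q f) {u v : p.V}
    (h : p.HasEdge u v) : q.HasEdge (f u) (f v) :=
  (edgeAtom_map f u v).subst (motive := (· ∈ q.atoms)) (hf.1 _ h)

theorem isHom_of_hasEdge {p q : CQ graphSchema 0} {f : p.V → q.V}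
    (hf : ∀ u v, p.HasEdge u v → q.HasEdge (f u) (f v)) : IsHom p q f := by
  refine isHom_iff.2 fun a ha => ?_
  obtain ⟨u, v, rfl⟩ := eq_edgeAtom a
  exact (edgeAtom_map f u v).symm ▸ hf u v ha

theorem coveredBy_range_union_range {q : CQ graphSchema n} {f g : Fin k → q.V}
    (hfg : ∀ i, q.HasEdge (f i) (g i)) : q.CoveredBy k (Set.range f ∪ Set.range g) := by
  classical
  refine ⟨Finset.univ.image fun i => edgeAtom (f i) (g i), ?_, ?_,
    Finset.card_image_le.trans (Finset.card_fin k).le⟩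
  · rw [Finset.coe_image, Set.image_subset_iff]
    exact fun i _ => hfg i
  · rw [Finset.set_biUnion_finset_image]
    rintro _ (⟨i, rfl⟩ | ⟨i, rfl⟩) <;>
      exact Set.mem_iUnion₂.2 ⟨i, Finset.mem_univ i, by simp [vars_edgeAtom]⟩

end CQ

theorem hasEdge_digraphCQ {V : Type} [Finite V] {G : Digraph V} {u v : V} :
    (digraphCQ G).HasEdge u v ↔ G.Adj u v := by
  constructor
  · rintro ⟨u', v', h, he⟩
    obtain ⟨rfl, rfl⟩ := edgeAtom_inj.1 he
    exact h
  · exact fun h => ⟨u, v, h, rfl⟩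

theorem IsTournament.asymm {V : Type} {G : Digraph V} (hG : IsTournament G) {u v : V}
    (huv : G.Adj u v) : ¬ G.Adj v u := by
  intro hvu
  rcases eq_or_ne u v with rfl | hne
  · exact hG.1 u huv
  · rcases hG.2 u v hne with ⟨-, h⟩ | ⟨-, h⟩
    · exact h hvu
    · exact h huv

/-! ### Band queries -/

/-- The band tournament of width `w` on the natural numbers: `u` and `v` are joined if they differ
by less than `w`; the edge goes to the larger one if their difference is odd, and to the smaller
one otherwise. -/
def BandAdj (w u v : ℕ) : Prop :=
  (u < v ∧ v < u + w ∧ (u + v) % 2 = 1) ∨ (v < u ∧ u < v + w ∧ (u + v) % 2 = 0)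

theorem bandAdj_or_bandAdj {w u v : ℕ} (huv : u < v) (hvu : v < u + w) :
    BandAdj w u v ∨ BandAdj w v u := by
  unfold BandAdj
  omega

/-- The Boolean query whose canonical database is the band tournament of width `w` on the numbers
below `N`. The other natural numbers are variables that occur in no atom. -/
def bandCQ (w N : ℕ) : CQ graphSchema 0 where
  V := ℕ
  atoms := {a | ∃ u v, u < N ∧ v < N ∧ BandAdj w u v ∧ a = edgeAtom u v}
  atoms_finite := (((Set.finite_Iio N).prod (Set.finite_Iio N)).image
    fun p => edgeAtom p.1 p.2).subset (by
      rintro _ ⟨u, v, hu, hv, -, rfl⟩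
      exact ⟨(u, v), ⟨hu, hv⟩, rfl⟩)
  free := Fin.elim0
  free_mem := fun i => i.elim0

section Band

open CQ

variable {w N ℓ : ℕ}

theorem hasEdge_bandCQ {u v : ℕ} :
    (bandCQ w N).HasEdge u v ↔ u < N ∧ v < N ∧ BandAdj w u v := by
  constructor
  · rintro ⟨u', v', hu, hv, h, he⟩
    obtain ⟨rfl, rfl⟩ := edgeAtom_inj.1 he
    exact ⟨hu, hv, h⟩
  · exact fun ⟨hu, hv, h⟩ => ⟨u, v, hu, hv, h, rfl⟩

/-- The path decomposition of a band query whose bags are the intervals of length `w`. -/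
def bandDecomposition (w n : ℕ) : (bandCQ w (n + w)).TreeDecomposition where
  Node := Fin (n + 1)
  node_finite := inferInstance
  tree := SimpleGraph.pathGraph (n + 1)
  isTree := isTree_pathGraph_succ n
  bag := fun t : Fin (n + 1) => (Set.Ico (t : ℕ) (t + w) : Set ℕ)
  bag_subset := fun _ _ _ => mem_exVars (q := bandCQ w (n + w)) _
  atom_subset := by
    rintro _ ⟨u, v, hu, hv, huv, rfl⟩
    refine ⟨⟨min n (min u v), by omega⟩, fun x hx => ?_⟩
    unfold BandAdj at huv
    change ℕ at x
    change min n (min u v) ≤ x ∧ x < min n (min u v) + w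
    have : x = u ∨ x = v := (vars_edgeAtom u v).subset hx.1
    omega
  preconnected := fun (y : ℕ) _ => by
    have hs : {t : Fin (n + 1) | y ∈ Set.Ico (t : ℕ) (t + w)}.OrdConnected := by
      refine ⟨fun a ha b hb c hc => ?_⟩
      simp only [Set.mem_ofPred_eq, Set.mem_Ico, Set.mem_Icc, Fin.le_def] at *
      omega
    have := preconnected_induce_image (G := SimpleGraph.pathGraph (n + 1)) hs (f := id)
      fun i _ j _ hij => .inl hij
    rwa [Set.image_id] at this

theorem bandCQ_mem_GHW (ℓ n : ℕ) : bandCQ (2 * ℓ) (n + 2 * ℓ) ∈ GHW ℓ := by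
  refine mem_GHW_iff.2 ⟨bandDecomposition (2 * ℓ) n, fun (t : Fin (n + 1)) => ?_⟩
  have hedge (i : Fin ℓ) :
      (bandCQ (2 * ℓ) (n + 2 * ℓ)).HasEdge (t + 2 * i : ℕ) (t + 2 * i + 1 : ℕ) :=
    hasEdge_bandCQ.2 ⟨by omega, by omega, .inl (by omega)⟩
  refine (coveredBy_range_union_range hedge).mono ?_
  rintro (x : ℕ) ⟨hx, hx'⟩
  rcases Nat.even_or_odd' (x - t) with ⟨i, hi | hi⟩
  · exact .inl ⟨⟨i, by omega⟩, show _ + 2 * i = x by omega⟩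
  · exact .inr ⟨⟨i, by omega⟩, show _ + 2 * i + 1 = x by omega⟩

variable {q : CQ graphSchema 0} {f : ℕ → q.V}

theorem exists_atom_of_isHom_bandCQ (hf : IsHom (bandCQ w N) q f) {u v : ℕ} (huv : u < v)
    (hvu : v < u + w) (hv : v < N) : ∃ a ∈ q.atoms, f u ∈ a.vars ∧ f v ∈ a.vars :=
  exists_atom_of_hasEdge_or_hasEdge <| (bandAdj_or_bandAdj huv hvu).imp
    (fun h => hf.hasEdge (hasEdge_bandCQ.2 ⟨huv.trans hv, hv, h⟩))
    (fun h => hf.hasEdge (hasEdge_bandCQ.2 ⟨hv, huv.trans hv, h⟩))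

theorem ne_of_le_add_of_isHom_bandCQ (hasymm : ∀ x y, q.HasEdge x y → ¬ q.HasEdge y x)
    (hw : Even w) (hf : IsHom (bandCQ w N) q f) {a b : ℕ} (hab : a < b) (hba : b ≤ a + w)
    (hb : b < N) : f a ≠ f b := by
  intro heq
  have hedge : ∀ {u v : ℕ}, u < N → v < N → BandAdj w u v → q.HasEdge (f u) (f v) :=
    fun hu hv h => hf.hasEdge (hasEdge_bandCQ.2 ⟨hu, hv, h⟩)
  obtain ⟨r, hr⟩ := hw
  rcases hba.lt_or_eq with hlt | rfl
  · have hloop : q.HasEdge (f a) (f a) := by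
      rcases bandAdj_or_bandAdj hab hlt with h | h
      · simpa only [← heq] using hedge (hab.trans hb) hb h
      · simpa only [← heq] using hedge hb (hab.trans hb) h
    exact hasymm _ _ hloop hloop
  · have hout : q.HasEdge (f a) (f (a + 1)) :=
      hedge (by omega) (by omega) (.inl (by omega))
    have hback : q.HasEdge (f (a + 1)) (f (a + w)) :=
      hedge (by omega) hb (.inl (by omega))
    exact hasymm _ _ hout (heq ▸ hback)

theorem preconnected_induce_gaifman_image (hf : IsHom (bandCQ w N) q f) (hw : 1 < w) {s : Set ℕ}
    (hs : s.OrdConnected) (hsN : ∀ x ∈ s, x < N) (hinj : Set.InjOn f s) :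
    (q.gaifman.induce (f '' s)).Preconnected := by
  refine preconnected_induce_image hs fun i hi j hj hij => ⟨?_, ?_⟩
  · exact fun h => hij.lt.ne (hinj hi hj h)
  · have hsucc := Nat.covBy_iff_add_one_eq.1 hij
    exact exists_atom_of_isHom_bandCQ hf hij.lt (by omega) (hsN j hj)

/-- The pieces of the interval from `a` to `b - 1` used as a bramble: for `i < w` the `i`-th piece
is `{a + i}`, and the `w`-th piece consists of the numbers from `a + w` on. -/
def intervalPiece (w a b i : ℕ) : Set ℕ := {x | a ≤ x ∧ x < b ∧ min x (a + w) = a + i}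

theorem ordConnected_intervalPiece (w a b i : ℕ) : (intervalPiece w a b i).OrdConnected := by
  refine ⟨fun x hx y hy z hz => ?_⟩
  simp only [intervalPiece, Set.mem_ofPred_eq, Set.mem_Icc] at *
  omega

theorem touches_image_intervalPiece (hf : IsHom (bandCQ w N) q f) (hw : 1 < w) {a b : ℕ}
    (hab : a + w < b) (hb : b < N) (heq : f a = f b) {i j : ℕ} (hij : i < j) (hj : j ≤ w) :
    q.Touches (f '' intervalPiece w a b i) (f '' intervalPiece w a b j) := by
  have hmem : ∀ l ≤ w, a + l ∈ intervalPiece w a b l := fun l hl => ⟨by omega, by omega, by omega⟩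
  by_cases hjw : j < i + w
  · obtain ⟨e, he, hie, hje⟩ := exists_atom_of_isHom_bandCQ hf (u := a + i) (v := a + j)
      (by omega) (by omega) (by omega)
    exact ⟨e, he, ⟨_, hie, _, hmem i (by omega), rfl⟩, ⟨_, hje, _, hmem j hj, rfl⟩⟩
  · -- The first and the last piece are joined only because `f a = f b`.
    obtain ⟨rfl, rfl⟩ : i = 0 ∧ j = w := by omega
    obtain ⟨e, he, hpe, hbe⟩ := exists_atom_of_isHom_bandCQ hf (u := b - 1) (v := b)
      (by omega) (by omega) hb
    exact ⟨e, he, ⟨_, heq ▸ hbe, _, hmem 0 (by omega), rfl⟩,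
      ⟨_, hpe, b - 1, ⟨by omega, by omega, by omega⟩, rfl⟩⟩

theorem ne_of_add_lt_of_isHom_bandCQ (hq : q ∈ GHW ℓ) (hw : 1 < w) (hℓ : 2 * ℓ ≤ w)
    (hf : IsHom (bandCQ w N) q f) {a b : ℕ} (hab : a + w < b) (hb : b < N)
    (hinj : Set.InjOn f (Set.Iio b)) : f a ≠ f b := by
  intro heq
  let J : Fin (w + 1) → Set ℕ := fun i => intervalPiece w a b i
  have hJ : ∀ i, J i ⊆ Set.Iio b := fun _ _ hx => hx.2.1
  have hconn : ∀ i, (q.gaifman.induce (f '' J i)).Preconnected := fun i =>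
    preconnected_induce_gaifman_image hf hw (ordConnected_intervalPiece w a b i)
      (fun x hx => (hJ i hx).trans hb) (hinj.mono (hJ i))
  have htouch : Pairwise fun i j => q.Touches (f '' J i) (f '' J j) := fun i j hij => by
    rcases hij.lt_or_gt with h | h
    · exact touches_image_intervalPiece hf hw hab hb heq h (by omega)
    · exact (touches_image_intervalPiece hf hw hab hb heq h (by omega)).symm
  have hdisj : Pairwise fun i j => Disjoint (f '' J i) (f '' J j) := fun i j hij =>
    Set.disjoint_image_image fun x hx y hy hxy => hij <| Fin.ext <| by
      obtain rfl := hinj (hJ i hx) (hJ j hy) hxy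
      exact Nat.add_left_cancel (hx.2.2.symm.trans hy.2.2)
  have : Nontrivial (Fin (w + 1)) := Fin.nontrivial_iff_two_le.2 (by omega)
  have hcard := card_le_of_touches hq (r := 2) (fun _ => le_rfl)
    (fun i x _ => mem_exVars x) hconn htouch hdisj
  rw [Nat.card_fin] at hcard
  omega

theorem injOn_of_isHom_bandCQ (hq : q ∈ GHW ℓ) (hℓ : 1 ≤ ℓ)
    (hasymm : ∀ x y, q.HasEdge x y → ¬ q.HasEdge y x) (hf : IsHom (bandCQ (2 * ℓ) N) q f) :
    Set.InjOn f (Set.Iio N) := by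
  suffices h : ∀ b ≤ N, Set.InjOn f (Set.Iio b) from h N le_rfl
  intro b hb
  induction b with
  | zero => simp
  | succ b ih =>
    have hinj := ih (by omega)
    rw [← Order.succ_eq_add_one, Order.Iio_succ_eq_insert, Set.injOn_insert (by simp)]
    refine ⟨hinj, ?_⟩
    rintro ⟨a, ha, heq⟩
    rcases le_or_gt b (a + 2 * ℓ) with hle | hlt
    · exact ne_of_le_add_of_isHom_bandCQ hasymm (even_two_mul ℓ) hf ha hle hb heq
    · exact ne_of_add_lt_of_isHom_bandCQ hq (by omega) le_rfl hf hlt hb hinj heq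

theorem exists_not_contained_bandCQ (hq : q ∈ GHW ℓ) (hℓ : 1 ≤ ℓ)
    (hasymm : ∀ x y, q.HasEdge x y → ¬ q.HasEdge y x) :
    ∃ n, ¬ q.Contained (bandCQ (2 * ℓ) (n + 2 * ℓ)) := by
  by_contra! hcont
  have hfin : (⋃ a ∈ q.atoms, a.vars).Finite :=
    q.atoms_finite.biUnion fun a _ => Set.finite_range a.args
  set n := (⋃ a ∈ q.atoms, a.vars).ncard
  have hatoms : (bandCQ (2 * ℓ) (n + 2 * ℓ)).atoms.Nonempty :=
    ⟨edgeAtom (0 : ℕ) (1 : ℕ), hasEdge_bandCQ.2 ⟨by omega, by omega, .inl (by omega)⟩⟩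
  have := nonempty_of_atoms_nonempty ((hcont n).atoms_nonempty hatoms)
  obtain ⟨f, hf⟩ : ∃ f : ℕ → q.V, IsHom (bandCQ (2 * ℓ) (n + 2 * ℓ)) q f :=
    (hcont n).exists_isHom
  have hinj : Set.InjOn f (Set.Iio (n + 1)) := (injOn_of_isHom_bandCQ hq hℓ hasymm hf).mono
    (Set.Iio_subset_Iio (by omega))
  have hmaps : f '' Set.Iio (n + 1) ⊆ ⋃ a ∈ q.atoms, a.vars := by
    rintro _ ⟨x, hx, rfl⟩
    rw [Set.mem_Iio] at hx
    obtain ⟨a, ha, hxa, -⟩ := exists_atom_of_isHom_bandCQ hf (u := x) (v := x + 1)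
      (by omega) (by omega) (by omega)
    exact Set.mem_biUnion ha hxa
  have hcard := Set.ncard_le_ncard hmaps hfin
  rw [hinj.ncard_image, Set.ncard_Iio_nat] at hcard
  omega

/-- Homomorphisms into an asymmetric query pull the asymmetry back to its overapproximation. -/
theorem not_isOverapproximation_of_isHom_bandCQ {q q' : CQ graphSchema 0}
    (hasymm : ∀ x y, q.HasEdge x y → ¬ q.HasEdge y x) (hℓ : 1 ≤ ℓ)
    (hband : ∀ N, ∃ f, IsHom (bandCQ (2 * ℓ) N) q f) : ¬ IsOverapproximation ℓ q q' := by
  intro h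
  have : Nonempty q.V := (hband 0).elim fun f _ => ⟨f (0 : ℕ)⟩
  obtain ⟨g, hg⟩ := h.2.1.exists_isHom
  obtain ⟨n, hn⟩ := exists_not_contained_bandCQ h.1 hℓ fun x y hxy hyx =>
    hasymm _ _ (hg.hasEdge hxy) (hg.hasEdge hyx)
  obtain ⟨f, hf⟩ := hband (n + 2 * ℓ)
  exact hn (h.contained (bandCQ_mem_GHW ℓ n) hf.contained)

end Band

/-! ### The rotational tournament -/

/-- The rotational tournament on the residues modulo `m`. For odd `m`, there is an edge from `i` to
`j` if and only if the residue of `j - i` is odd. -/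
def rotationalTournament (m : ℕ) : Digraph (Fin m) := ⟨fun i j => BandAdj m i j⟩

section Rotational

variable {m : ℕ}

theorem isTournament_rotationalTournament (m : ℕ) : IsTournament (rotationalTournament m) := by
  refine ⟨fun u h => ?_, fun u v huv => ?_⟩
  · rcases h with ⟨h, -⟩ | ⟨h, -⟩ <;> exact lt_irrefl _ h
  · have := Fin.val_ne_of_ne huv
    rw [xor_iff_or_and_not_and]
    simp only [rotationalTournament, BandAdj]
    omega

theorem firstThreeCycle_rotationalTournament (hm : 3 ≤ m) :
    FirstThreeCycle (rotationalTournament m) := by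
  have h₁ : BandAdj m 0 1 := .inl (by omega)
  have h₂ : BandAdj m 1 2 := .inl (by omega)
  have h₃ : BandAdj m 2 0 := .inr (by omega)
  exact ⟨hm, h₁, h₂, h₃⟩

theorem rotationalTournament_adj_ofNat [NeZero m] (hm : Odd m) {w u v : ℕ} (hw : w ≤ m)
    (h : BandAdj w u v) : (rotationalTournament m).Adj (Fin.ofNat m u) (Fin.ofNat m v) := by
  have hmod : ∀ x d, d < m → (x + d) % m = x % m + d ∨ (x + d) % m + m = x % m + d := by
    intro x d hd
    rw [Nat.add_mod_eq_ite, Nat.mod_eq_of_lt hd]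
    split <;> omega
  have hlt : ∀ x, x % m < m := fun x => Nat.mod_lt x (Nat.pos_of_neZero m)
  have hu := hlt u
  have hv := hlt v
  obtain ⟨r, hr⟩ := hm
  change BandAdj m (u % m) (v % m)
  rcases h with ⟨huv, hvu, hpar⟩ | ⟨hvu, huv, hpar⟩
  · obtain ⟨d, rfl⟩ := Nat.exists_eq_add_of_le huv.le
    have := hmod u d (by omega)
    unfold BandAdj
    omega
  · obtain ⟨d, rfl⟩ := Nat.exists_eq_add_of_le hvu.le
    have := hmod v d (by omega)
    unfold BandAdj
    omega

theorem isHom_bandCQ_rotationalTournament [NeZero m] (hm : Odd m) {w : ℕ} (hw : w ≤ m) (N : ℕ) :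
    CQ.IsHom (bandCQ w N) (digraphCQ (rotationalTournament m)) (Fin.ofNat m) :=
  CQ.isHom_of_hasEdge fun _ _ h =>
    hasEdge_digraphCQ.2 (rotationalTournament_adj_ofNat hm hw (hasEdge_bandCQ.1 h).2.2)

theorem digraphCQ_rotationalTournament_mem_GHW (hm : Odd m) (hm₁ : 1 < m) {k : ℕ}
    (hmk : m ≤ 2 * k) : digraphCQ (rotationalTournament m) ∈ CQ.GHW k := by
  have : NeZero m := ⟨by omega⟩
  have hedge (i : Fin k) : (digraphCQ (rotationalTournament m)).HasEdge
      (Fin.ofNat m (2 * i)) (Fin.ofNat m (2 * i + 1)) :=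
    hasEdge_digraphCQ.2 (rotationalTournament_adj_ofNat hm hm₁ (.inl (by omega)))
  refine CQ.mem_GHW_of_coveredBy_exVars ((CQ.coveredBy_range_union_range hedge).mono ?_)
  rintro (x : Fin m) -
  rcases Nat.even_or_odd' (x : ℕ) with ⟨i, hi | hi⟩
  · exact .inl ⟨⟨i, by omega⟩, (congrArg (Fin.ofNat m) hi.symm).trans (Fin.ofNat_val_eq_self x)⟩
  · exact .inr ⟨⟨i, by omega⟩, (congrArg (Fin.ofNat m) hi.symm).trans (Fin.ofNat_val_eq_self x)⟩

theorem adj_iff_of_conn_eq {G : Digraph (Fin m)} {u v p : Fin m} {B : Finset (Fin m)}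
    (h : conn G u B = conn G v B) (hp : p ∈ B) : G.Adj u p ↔ G.Adj v p := by
  have := congrFun h p
  simp only [conn, hp, not_true_eq_false, if_false] at this
  split_ifs at this <;> simp_all

theorem exists_notMem_add_one_mem [NeZero m] {B : Finset (Fin m)} {v b : Fin m} (hv : v ∉ B)
    (hb : b ∈ B) : ∃ a ∉ B, a + 1 ∈ B := by
  by_contra! h
  have hall : ∀ i : ℕ, v + Fin.ofNat m i ∉ B := by
    intro i
    induction i with
    | zero => simpa using hv
    | succ i ih =>
      have hsucc : Fin.ofNat m i + 1 = Fin.ofNat m (i + 1) := Fin.ext (Nat.add_mod i 1 m).symm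
      rw [← hsucc, ← add_assoc]
      exact h _ ih
  have := hall (b - v : Fin m)
  rw [Fin.ofNat_val_eq_self, add_sub_cancel] at this
  exact this hb

theorem val_add_one_eq_ite [NeZero m] (hm : 1 < m) (u : Fin m) :
    ((u + 1 : Fin m) : ℕ) = if (u : ℕ) + 1 = m then 0 else (u : ℕ) + 1 := by
  rw [Fin.val_add_eq_ite, Fin.val_one', Nat.mod_eq_of_lt hm]
  split_ifs <;> omega

theorem rotationalTournament_adj_add_one [NeZero m] (hm : Odd m) (hm₁ : 1 < m) (u : Fin m) :
    (rotationalTournament m).Adj u (u + 1) := by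
  change BandAdj m u (u + 1 : Fin m)
  obtain ⟨r, hr⟩ := hm
  rw [val_add_one_eq_ite hm₁, BandAdj]
  split_ifs <;> omega

theorem not_rotationalTournament_adj_add_one_left [NeZero m] (hm : Odd m) (hm₁ : 1 < m)
    {u v : Fin m} (h : (rotationalTournament m).Adj u v) :
    ¬ (rotationalTournament m).Adj (u + 1) v := by
  change ¬ BandAdj m (u + 1 : Fin m) v
  obtain ⟨r, hr⟩ := hm
  change BandAdj m u v at h
  rw [val_add_one_eq_ite hm₁, BandAdj]
  rw [BandAdj] at h
  split_ifs <;> omega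

/-- If all nodes outside `B` were connected to `B` in the same way, one of them would be followed
by a node `a + 1` of `B`. Every node `u ≠ a` outside `B` would then have an edge to `a + 1`, and
`u + 1` could be neither outside nor inside `B`. -/
theorem dagger_rotationalTournament (hm : Odd m) : Dagger (rotationalTournament m) := by
  intro B hB hBm v hv
  by_contra! hconn
  have hm₁ : 1 < m := by omega
  have : NeZero m := ⟨by omega⟩
  have hadj : ∀ u ∉ B, ∀ u' ∉ B, ∀ p ∈ B, (rotationalTournament m).Adj u p →
      (rotationalTournament m).Adj u' p := fun u hu u' hu' _ hp =>
    (adj_iff_of_conn_eq ((hconn u hu).symm.trans (hconn u' hu')) hp).1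
  obtain ⟨b, hb⟩ := Finset.card_pos.1 (by omega : 0 < B.card)
  obtain ⟨a, ha, haB⟩ := exists_notMem_add_one_mem hv hb
  obtain ⟨u, hu, hua⟩ : ∃ u ∈ Bᶜ, u ≠ a := by
    refine Finset.exists_mem_ne ?_ a
    rw [Finset.card_compl, Fintype.card_fin]
    omega
  rw [Finset.mem_compl] at hu
  have hua₁ := hadj a ha u hu _ haB (rotationalTournament_adj_add_one hm hm₁ a)
  have hnot := not_rotationalTournament_adj_add_one_left hm hm₁ hua₁
  by_cases huB : u + 1 ∈ B
  · have hau := hadj u hu a ha _ huB (rotationalTournament_adj_add_one hm hm₁ u)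
    rcases (isTournament_rotationalTournament m).2 (u + 1) (a + 1) (by simpa using hua) with h | h
    · exact hnot h.1
    · exact not_rotationalTournament_adj_add_one_left hm hm₁ hau h.1
  · exact hnot (hadj a ha _ huB _ haB (rotationalTournament_adj_add_one hm hm₁ a))

end Rotational

theorem mainTheorem7 (k : ℕ) (hk : 1 < k) :
    ∃ G : Digraph (Fin (2 * k - 1)),
      IsTournament G ∧ FirstThreeCycle G ∧ Dagger G ∧
      digraphCQ G ∈ CQ.GHW k ∧
      ∀ ℓ : ℕ, 1 ≤ ℓ → ℓ < k →
        ¬ ∃ q' : CQ graphSchema 0, CQ.IsOverapproximation ℓ (digraphCQ G) q' := by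
  have hodd : Odd (2 * k - 1) := ⟨k - 1, by omega⟩
  have : NeZero (2 * k - 1) := ⟨by omega⟩
  have htour := isTournament_rotationalTournament (2 * k - 1)
  refine ⟨rotationalTournament (2 * k - 1), htour, firstThreeCycle_rotationalTournament (by omega),
    dagger_rotationalTournament hodd,
    digraphCQ_rotationalTournament_mem_GHW hodd (by omega) (by omega), ?_⟩
  rintro ℓ hℓ hℓk ⟨q', hq'⟩
  refine not_isOverapproximation_of_isHom_bandCQ (fun x y hxy hyx => ?_) hℓ
    (fun N => ⟨_, isHom_bandCQ_rotationalTournament hodd (by omega) N⟩) hq'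
  exact htour.asymm (hasEdge_digraphCQ.1 hxy) (hasEdge_digraphCQ.1 hyx)
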